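/- Let $f_{abc}$ ($a,b,c=1,\dots,d$) be real structure constants of a Lie algebra in a basis orthonormal for an invariant inner product, i.e. $f_{abc}$ is totally antisymmetric and satisfies the Jacobi identity, and let $\theta\neq 0$ be real. Repeated indices are summed. For $X\in\mathbb R^d$ put $F_{ab}(X)=f_{acb}X_c$, let $$E_j{}^a(X)=\left[\frac{1-e^{-F(\theta X)}}{F(\theta X)}\right]_{ja}=\left[\sum_{n\ge 0}\frac{(-F(\theta X))^n}{(n+1)!}\right]_{ja},\qquad g_{jk}(X)=E_j{}^a(X)E_k{}^a(X),$$ and, at every $X$ where the matrix $(E_j{}^a(X))$ is invertible, let $$E_a{}^j(X)=\left[\frac{F(\theta X)}{1-e^{-F(\theta X)}}\right]_{aj}$$ be its inverse. Let $\hat D_a=E_a{}^j\,\partial/\partial X^j$ and $\hat H=-\tfrac12\hat D_a\hat D_a$. Write $g=\det(g_{jk})$ and $(g^{jk})=(g_{jk})^{-1}$. Then: (i) $\hat H=-\tfrac12\triangle$, where $\triangle=\frac1{\sqrt g}\,\partial_j\big(\sqrt g\,g^{jk}\big)\partial_k$ is the Laplace--Beltrami operator $\triangle\psi=\frac1{\sqrt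 g}\,\partial_j\big(\sqrt g\,g^{jk}\,\partial_k\psi\big)$ of the metric $g_{jk}$: at every $X$ where $(E_j{}^a(X))$ is invertible, $(\hat H\psi)(X)=-\tfrac12(\triangle\psi)(X)$ for every complex-valued $\psi$ that is $C^2$ at $X$. (ii) $g_{jk}$ is the bi-invariant metric on the group manifold in the exponential coordinates $\omega(X)=\exp(i\theta X^jt_j)$. That is, $g_{jk}(0)=\delta_{jk}$, and for all complex square matrices $t_1,\dots,t_d$ with $[t_a,t_b]=if_{abc}t_c$: if the $t_a$ are linearly independent over $\mathbb R$, then $g_{jk}$ is invariant under left and right group rotations (whenever a map $\Phi$ of $\mathbb R^d$ to itself, differentiable at $X$, satisfies $\omega(\Phi(Y))=\omega(U)\,\omega(Y)\,\omega(V)$ for all $Y$ near $X$ and some fixed $U,V\in\mathbb R^d$, its derivative at $X$ carries the form $g(X)$ isometrically into $g(\Phi(X))$); and if $\operatorname{Tr}(t_at_b)=h\,\delta_{ab}$ with a real $h\neq0$, then at every $X$ $$g_{jk}=\frac1{h\theta^2}\operatorname{Tr}\{\partial_j\omega^{-1}\,\partial_k\omega\}.$$ -/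

import Mathlib

open scoped Matrix Topology

noncomputable section

namespace GroupHamiltonian

/-- Real structure constants `f a b c` of a Lie algebra, `[t_a, t_b] = i f_{abc} t_c`, in a basis
that is orthonormal for an invariant inner product: `f` is totally antisymmetric and satisfies
the Jacobi identity. -/
structure IsStructureConstants {d : ℕ} (f : Fin d → Fin d → Fin d → ℝ) : Prop where
  antisymm_left : ∀ a b c, f b a c = -f a b c
  antisymm_right : ∀ a b c, f a c b = -f a b c
  jacobi : ∀ a b c k,
    ∑ e, (f a b e * f e c k + f b c e * f e a k + f c a e * f e b k) = 0

/-- The matrix `F(X)`, with entries `F_{ab}(X) = f_{acb} X_c`. -/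
def matF {d : ℕ} (f : Fin d → Fin d → Fin d → ℝ) (X : Fin d → ℝ) :
    Matrix (Fin d) (Fin d) ℝ :=
  Matrix.of fun a b => ∑ c, f a c b * X c

/-- The matrix function `(1 - e^{-A}) / A = ∑ (-A)^n / (n+1)!` (everywhere convergent). -/
def phi {d : ℕ} (A : Matrix (Fin d) (Fin d) ℝ) : Matrix (Fin d) (Fin d) ℝ :=
  ∑' n : ℕ, (((n + 1).factorial : ℝ)⁻¹) • (-A) ^ n

/-- The inverse vielbein `E_j^a(X)`, the matrix `(1 - e^{-F(θX)}) / F(θX)`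
(row `j`, column `a`). -/
def invVielbein {d : ℕ} (f : Fin d → Fin d → Fin d → ℝ) (θ : ℝ) (X : Fin d → ℝ) :
    Matrix (Fin d) (Fin d) ℝ :=
  phi (matF f (θ • X))

/-- The points at which `F(θX) / (1 - e^{-F(θX)})` is defined, that is, at which no eigenvalue of
`F(θX)` is a nonzero integer multiple of `2πi`. -/
def regularSet {d : ℕ} (f : Fin d → Fin d → Fin d → ℝ) (θ : ℝ) : Set (Fin d → ℝ) :=
  {X | IsUnit (invVielbein f θ X).det}

/-- The vielbein `E_a^j(X)`, the matrix `F(θX) / (1 - e^{-F(θX)})` (row `a`, column `j`), for `X`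
in `regularSet f θ`. -/
def vielbein {d : ℕ} (f : Fin d → Fin d → Fin d → ℝ) (θ : ℝ) (X : Fin d → ℝ) :
    Matrix (Fin d) (Fin d) ℝ :=
  (invVielbein f θ X)⁻¹

/-- The partial derivative `∂_j`. -/
def partialD {d : ℕ} (j : Fin d) (ψ : (Fin d → ℝ) → ℂ) (X : Fin d → ℝ) : ℂ :=
  lineDeriv ℝ ψ X (Pi.single j 1)

/-- The generators of right group rotations, `D_a = E_a^j ∂_j`. -/
def opD {d : ℕ} (f : Fin d → Fin d → Fin d → ℝ) (θ : ℝ) (a : Fin d)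
    (ψ : (Fin d → ℝ) → ℂ) (X : Fin d → ℝ) : ℂ :=
  ∑ j, (vielbein f θ X a j : ℂ) * partialD j ψ X

/-- The quantum Hamiltonian `H = -(1/2) D_a D_a`. -/
def hamiltonian {d : ℕ} (f : Fin d → Fin d → Fin d → ℝ) (θ : ℝ)
    (ψ : (Fin d → ℝ) → ℂ) (X : Fin d → ℝ) : ℂ :=
  -(1 / 2) * ∑ a, opD f θ a (opD f θ a ψ) X

/-- The covariant metric `g_{jk} = E_j^a E_k^a`. -/
def metric {d : ℕ} (f : Fin d → Fin d → Fin d → ℝ) (θ : ℝ) (X : Fin d → ℝ) :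
    Matrix (Fin d) (Fin d) ℝ :=
  Matrix.of fun j k => ∑ a, invVielbein f θ X j a * invVielbein f θ X k a

/-- The Laplace–Beltrami operator `(1/√g) ∂_j (√g g^{jk} ∂_k ψ)` of a metric `g_{jk}`, with
`g = det (g_{jk})` and `(g^{jk})` the inverse matrix of `(g_{jk})`. -/
def laplaceBeltrami {d : ℕ} (g : (Fin d → ℝ) → Matrix (Fin d) (Fin d) ℝ)
    (ψ : (Fin d → ℝ) → ℂ) (X : Fin d → ℝ) : ℂ :=
  ((1 / √(g X).det : ℝ) : ℂ) *
    ∑ j, partialD j (fun Y => ∑ k, ((√(g Y).det * (g Y)⁻¹ j k : ℝ) : ℂ) * partialD k ψ Y) X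

/-- The matrices `t_a` represent the Lie algebra: `[t_a, t_b] = i f_{abc} t_c`. -/
def IsRepresentation {d N : ℕ} (f : Fin d → Fin d → Fin d → ℝ)
    (t : Fin d → Matrix (Fin N) (Fin N) ℂ) : Prop :=
  ∀ a b, t a * t b - t b * t a = Complex.I • ∑ c, (f a b c : ℂ) • t c

/-- The exponential parametrization `ω(X) = exp (i θ X^j t_j)` of the group. -/
def omega {d N : ℕ} (t : Fin d → Matrix (Fin N) (Fin N) ℂ) (θ : ℝ) (X : Fin d → ℝ) :
    Matrix (Fin N) (Fin N) ℂ :=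
  NormedSpace.exp ((Complex.I * (θ : ℂ)) • ∑ j, (X j : ℂ) • t j)

/-- The entrywise partial derivative `∂_j` of a matrix-valued function. -/
def matPartialD {d N : ℕ} (j : Fin d) (M : (Fin d → ℝ) → Matrix (Fin N) (Fin N) ℂ)
    (X : Fin d → ℝ) : Matrix (Fin N) (Fin N) ℂ :=
  Matrix.of fun m n => partialD j (fun Y => M Y m n) X

/-- The metric `g`, given in the coordinates `X` on the group with parametrization `ω`, is
invariant under left and right group rotations: every map `Φ` of the coordinates that expresses
`ω ↦ ω(U) ω ω(V)` near a point preserves `g` at this point. -/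
def IsBiInvariant {d N : ℕ} (ω : (Fin d → ℝ) → Matrix (Fin N) (Fin N) ℂ)
    (g : (Fin d → ℝ) → Matrix (Fin d) (Fin d) ℝ) : Prop :=
  ∀ (U V X : Fin d → ℝ) (Φ : (Fin d → ℝ) → (Fin d → ℝ)), DifferentiableAt ℝ Φ X →
    (∀ᶠ Y in 𝓝 X, ω (Φ Y) = ω U * ω Y * ω V) →
    ∀ v w : Fin d → ℝ,
      (fderiv ℝ Φ X v) ⬝ᵥ (g (Φ X) *ᵥ (fderiv ℝ Φ X w)) = v ⬝ᵥ (g X *ᵥ w)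

end GroupHamiltonian

end

/-!
Write `E` for the inverse vielbein, `Ψ = Eᵀ = phi (-F(θX))` and `T X = iθ X^j t_j`. Everything rests
on the derivative of the exponential: since `[T X, T v] = -T (F(θX) v)`, Duhamel's formula gives
`∂_v exp (T X) = exp (T X) T (Ψ(X) v)` (`IsRep.hasFDerivAt_exp`). So the columns of `E` are the
left-invariant forms `ω⁻¹ dω`, and the `D_a` are the dual left-invariant fields.

The trace formula is immediate from `ω⁻¹ ∂_j ω = iθ E_j^a t_a`. For bi-invariance,
left translations preserve `ω⁻¹ dω` and the right translation by `ω(V)` conjugates it by `ω(V)`,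
which acts on coordinates by `exp (F(θV))`; this matrix is orthogonal because `F` is antisymmetric,
so the form `g = E Eᵀ` is preserved (`IsRepresentation.isBiInvariant`).

For the Laplacian, `√g = |det E|` and `g^{jk} = E_a^j E_a^k`, so `△ = D_a D_a` holds once each `D_a`
is divergence free: `∂_j (det E · E_a^j) = 0`. By the Maurer–Cartan equation for `E` this
divergence is the trace of an antisymmetric matrix. The Maurer–Cartan equation itself
(`IsStructureConstants.maurerCartan`) expresses the symmetry of the second derivative of
`exp (T X)` for a faithful `T`. No faithful representation is given, so the adjoint one is used;
it determines the equation up to the centre, on which `F` acts by zero and `E` is the identity, so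
that the central component holds trivially.
-/

open scoped Matrix Topology

noncomputable section

namespace GroupHamiltonian

/-! ### The derivative of the exponential in a Banach algebra -/

section Duhamel
variable {𝔸 : Type*} [NormedRing 𝔸] [NormedAlgebra ℝ 𝔸] [CompleteSpace 𝔸]

theorem exp_neg_mul_exp' (x : 𝔸) : NormedSpace.exp (-x) * NormedSpace.exp x = 1 := by
  let _ := NormedAlgebra.restrictScalars ℚ ℝ 𝔸
  rw [← NormedSpace.exp_add_of_commute (Commute.neg_left (Commute.refl x))]
  simp

theorem exp_mul_exp_neg' (x : 𝔸) : NormedSpace.exp x * NormedSpace.exp (-x) = 1 := by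
  simpa using exp_neg_mul_exp' (-x)

theorem continuous_exp' : Continuous (NormedSpace.exp : 𝔸 → 𝔸) := by
  let _ := NormedAlgebra.restrictScalars ℚ ℝ 𝔸
  exact NormedSpace.exp_continuous

theorem contDiff_exp' : ContDiff ℝ 2 (NormedSpace.exp : 𝔸 → 𝔸) :=
  contDiff_iff_contDiffAt.2 fun x => (NormedSpace.exp_analytic (𝕂 := ℝ) x).contDiffAt

/-- Duhamel's formula. It comes from integrating the derivative of
`s ↦ exp (-s x) exp (s (x + ε y))` over `[0, 1]`. -/
theorem exp_neg_mul_exp_add_smul (x y : 𝔸) (ε : ℝ) :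
    NormedSpace.exp (-x) * NormedSpace.exp (x + ε • y) = 1 + ε • ∫ s in (0 : ℝ)..1,
      NormedSpace.exp (s • -x) * y * NormedSpace.exp (s • (x + ε • y)) := by
  have h := intervalIntegral.integral_eq_sub_of_hasDerivAt (a := 0) (b := 1)
    (f := fun s : ℝ => NormedSpace.exp (s • -x) * NormedSpace.exp (s • (x + ε • y)))
    (f' := fun s : ℝ => ε • (NormedSpace.exp (s • -x) * y * NormedSpace.exp (s • (x + ε • y))))
    (fun s _ => by
      have := (hasDerivAt_exp_smul_const (𝕂 := ℝ) (-x) s).mul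
        (hasDerivAt_exp_smul_const' (𝕂 := ℝ) (x + ε • y) s)
      refine this.congr_deriv ?_
      simp only [mul_neg, neg_mul, add_mul, mul_add, smul_mul_assoc, mul_smul_comm, mul_assoc,
        neg_add_cancel_left])
    (by
      apply Continuous.intervalIntegrable
      have h1 : Continuous fun s : ℝ => NormedSpace.exp (s • -x) :=
        continuous_exp'.comp (by fun_prop)
      have h2 : Continuous fun s : ℝ => NormedSpace.exp (s • (x + ε • y)) :=
        continuous_exp'.comp (by fun_prop)
      exact ((h1.mul continuous_const).mul h2).const_smul ε)
  rw [intervalIntegral.integral_smul] at h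
  rw [h]
  simp

/-- The derivative of the exponential at `x` in the direction `y`, which need not commute with `x`:
by Duhamel's formula the difference quotient at `ε` is an integral depending continuously on `ε`,
also at `ε = 0`. -/
theorem hasDerivAt_exp_add_smul (x y : 𝔸) :
    HasDerivAt (fun ε : ℝ => NormedSpace.exp (x + ε • y))
      (NormedSpace.exp x * ∫ s in (0 : ℝ)..1,
        NormedSpace.exp (s • -x) * y * NormedSpace.exp (s • x)) 0 := by
  set K : ℝ → 𝔸 := fun ε => ∫ s in (0 : ℝ)..1,
      NormedSpace.exp (s • -x) * y * NormedSpace.exp (s • (x + ε • y)) with hK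
  have hKc : Continuous K := by
    apply intervalIntegral.continuous_parametric_intervalIntegral_of_continuous'
    have h1 : Continuous fun p : ℝ × ℝ => NormedSpace.exp (p.2 • -x) :=
      continuous_exp'.comp (by fun_prop)
    have h2 : Continuous fun p : ℝ × ℝ => NormedSpace.exp (p.2 • (x + p.1 • y)) :=
      continuous_exp'.comp (by fun_prop)
    exact (h1.mul continuous_const).mul h2
  have hd : HasDerivAt (fun ε : ℝ => ε • K ε) (K 0) 0 := by
    rw [hasDerivAt_iff_tendsto_slope_zero]
    have : Filter.Tendsto K (𝓝[≠] 0) (𝓝 (K 0)) := (hKc.tendsto 0).mono_left nhdsWithin_le_nhds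
    refine this.congr' ?_
    filter_upwards [self_mem_nhdsWithin] with ε hε
    simp [smul_smul, inv_mul_cancel₀ (show ε ≠ 0 from hε)]
  have h := (hd.const_add 1).const_mul (NormedSpace.exp x)
  have hK0 : K 0 = ∫ s in (0 : ℝ)..1,
      NormedSpace.exp (s • -x) * y * NormedSpace.exp (s • x) := by simp [hK]
  rw [hK0] at h
  refine h.congr_of_eventuallyEq (Filter.Eventually.of_forall fun ε => ?_)
  change _ = NormedSpace.exp x * (1 + ε • K ε)
  rw [hK, ← exp_neg_mul_exp_add_smul, ← mul_assoc, exp_mul_exp_neg', one_mul]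

theorem hasSum_integral_exp_smul (x : 𝔸) :
    HasSum (fun n : ℕ => (((n + 1).factorial : ℝ)⁻¹) • x ^ n)
      (∫ s in (0 : ℝ)..1, NormedSpace.exp (s • x)) := by
  have h : ∀ s : ℝ, NormedSpace.exp (s • x) =
      ∑' n : ℕ, (s ^ n * ((n.factorial : ℝ)⁻¹)) • x ^ n := by
    intro s
    rw [NormedSpace.exp_eq_tsum ℝ]
    refine tsum_congr fun n => ?_
    rw [smul_pow, smul_smul, mul_comm]
  have hs := intervalIntegral.hasSum_intervalIntegral_of_summable_norm (a := 0) (b := 1)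
    (f := fun n : ℕ => (⟨fun s : ℝ => (s ^ n * ((n.factorial : ℝ)⁻¹)) • x ^ n, by fun_prop⟩ :
      C(ℝ, 𝔸))) ?_
  · simp only [h]
    refine hs.congr_fun fun n => ?_
    simp only [ContinuousMap.coe_mk]
    rw [intervalIntegral.integral_smul_const, intervalIntegral.integral_mul_const, integral_pow]
    congr 1
    rw [Nat.factorial_succ]
    push_cast
    simp [mul_comm]
  · refine Summable.of_nonneg_of_le (fun _ => norm_nonneg _) (fun n => ?_)
      (NormedSpace.norm_expSeries_summable' (𝕂 := ℝ) x)
    refine (ContinuousMap.norm_le _ (norm_nonneg _)).2 fun s => ?_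
    have hs : (s : ℝ) ∈ Set.Icc (0 : ℝ) 1 := by
      have := s.2
      simpa using this
    simp only [ContinuousMap.restrict_apply, ContinuousMap.coe_mk, norm_smul, norm_mul, norm_pow]
    gcongr
    refine mul_le_of_le_one_left (norm_nonneg _) (pow_le_one₀ (norm_nonneg _) ?_)
    rw [Real.norm_of_nonneg hs.1]
    exact hs.2

end Duhamel

/-! ### The matrix function `phi` -/

section Matrices
attribute [local instance] Matrix.linftyOpNormedAddCommGroup Matrix.linftyOpNormedSpace
  Matrix.linftyOpNormedRing Matrix.linftyOpNormedAlgebra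

variable {d : ℕ}

theorem phi_eq_ofScalarsSum : (phi : Matrix (Fin d) (Fin d) ℝ → _) =
    FormalMultilinearSeries.ofScalarsSum
      (fun n : ℕ => (-1 : ℝ) ^ n * ((n + 1).factorial : ℝ)⁻¹) := by
  rw [FormalMultilinearSeries.ofScalarsSum_eq_tsum]
  funext A
  unfold phi
  congr 1
  funext n
  rw [mul_comm, mul_smul, ← neg_one_smul ℝ A, smul_pow]

/-- `phi` is given by a power series with infinite radius of convergence. -/
theorem contDiff_phi : ContDiff ℝ 2 (phi : Matrix (Fin d) (Fin d) ℝ → _) := by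
  rw [phi_eq_ofScalarsSum]
  set c : ℕ → ℝ := fun n : ℕ => (-1 : ℝ) ^ n * ((n + 1).factorial : ℝ)⁻¹ with hc
  have hr : (FormalMultilinearSeries.ofScalars (Matrix (Fin d) (Fin d) ℝ) c).radius = ⊤ := by
    apply FormalMultilinearSeries.ofScalars_radius_eq_top_of_tendsto
    · exact Filter.Eventually.of_forall fun n => by simp [hc, Nat.factorial_ne_zero]
    · have h : ∀ n : ℕ, ‖c n.succ‖ / ‖c n‖ = ((n + 1 : ℕ) + 1 : ℝ)⁻¹ := fun n => by
        have : ((n + 1).factorial : ℝ) ≠ 0 := by positivity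
        simp only [hc, norm_mul, norm_pow, norm_neg, norm_one, one_pow, one_mul, norm_inv,
          Nat.succ_eq_add_one, Nat.factorial_succ (n + 1), RCLike.norm_natCast]
        push_cast
        field_simp
      simp only [h]
      have := tendsto_one_div_add_atTop_nhds_zero_nat (𝕜 := ℝ)
      simpa using (Filter.tendsto_add_atTop_iff_nat 1).2 this
  have := (FormalMultilinearSeries.ofScalars (Matrix (Fin d) (Fin d) ℝ) c).hasFPowerSeriesOnBall
    (by rw [hr]; simp)
  rw [hr] at this
  refine contDiff_iff_contDiffAt.2 fun x => (this.analyticAt_of_mem ?_).contDiffAt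
  simp

theorem integral_exp_smul (B : Matrix (Fin d) (Fin d) ℝ) :
    ∫ s in (0 : ℝ)..1, NormedSpace.exp (s • B) = phi (-B) := by
  refine (hasSum_integral_exp_smul B).tsum_eq.symm.trans ?_
  rw [phi, neg_neg]
  rfl

theorem hasSum_phi (A : Matrix (Fin d) (Fin d) ℝ) :
    HasSum (fun n : ℕ => (((n + 1).factorial : ℝ)⁻¹) • (-A) ^ n) (phi A) :=
  (hasSum_integral_exp_smul (-A)).summable.hasSum

end Matrices

/-! ### The exponential along a representation -/

section Representations
attribute [local instance] Matrix.linftyOpNormedAddCommGroup Matrix.linftyOpNormedSpace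
  Matrix.linftyOpNormedRing Matrix.linftyOpNormedAlgebra

variable {d : ℕ} {𝔸 : Type*} [NormedRing 𝔸] [NormedAlgebra ℝ 𝔸] [CompleteSpace 𝔸]

/-- The continuous linear map `M ↦ M v`, for a fixed vector `v`. -/
def mulVecCLM (v : Fin d → ℝ) : Matrix (Fin d) (Fin d) ℝ →L[ℝ] (Fin d → ℝ) :=
  LinearMap.toContinuousLinearMap
    { toFun := fun M => M *ᵥ v
      map_add' := fun M N => Matrix.add_mulVec M N v
      map_smul' := fun c M => Matrix.smul_mulVec c M v }

theorem _root_.HasDerivAt.matrix_mulVec_const {M : ℝ → Matrix (Fin d) (Fin d) ℝ}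
    {M' : Matrix (Fin d) (Fin d) ℝ} {s : ℝ} (h : HasDerivAt M M' s) (v : Fin d → ℝ) :
    HasDerivAt (fun s => M s *ᵥ v) (M' *ᵥ v) s :=
  (mulVecCLM v).hasFDerivAt.comp_hasDerivAt s h

theorem integral_mulVec_const {M : ℝ → Matrix (Fin d) (Fin d) ℝ} (h : Continuous M)
    (v : Fin d → ℝ) : ∫ s in (0 : ℝ)..1, M s *ᵥ v = (∫ s in (0 : ℝ)..1, M s) *ᵥ v :=
  (mulVecCLM v).intervalIntegral_comp_comm (h.intervalIntegrable 0 1)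

/-- If `ad x` acts on the range of `T` as `-B`, then conjugation by `exp (s x)` acts on it as
`exp (s B)`: the function `s ↦ exp (s x) T (exp (s B) v) exp (-s x)` has derivative zero. -/
theorem exp_conj_apply (T : (Fin d → ℝ) →L[ℝ] 𝔸) {x : 𝔸} {B : Matrix (Fin d) (Fin d) ℝ}
    (hx : ∀ v, x * T v - T v * x = -T (B *ᵥ v)) (v : Fin d → ℝ) (s : ℝ) :
    NormedSpace.exp (s • -x) * T v * NormedSpace.exp (s • x) =
      T (NormedSpace.exp (s • B) *ᵥ v) := by
  have hd : ∀ s : ℝ, HasDerivAt (fun s : ℝ => NormedSpace.exp (s • x) *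
      T (NormedSpace.exp (s • B) *ᵥ v) * NormedSpace.exp (s • -x)) 0 s := by
    intro s
    have h1 := hasDerivAt_exp_smul_const (𝕂 := ℝ) x s
    have h2 : HasDerivAt (fun s : ℝ => T (NormedSpace.exp (s • B) *ᵥ v))
        (T (B *ᵥ NormedSpace.exp (s • B) *ᵥ v)) s := by
      rw [Matrix.mulVec_mulVec]
      exact T.hasFDerivAt.comp_hasDerivAt s
        ((hasDerivAt_exp_smul_const' (𝕂 := ℝ) B s).matrix_mulVec_const v)
    have h3 := hasDerivAt_exp_smul_const' (𝕂 := ℝ) (-x) s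
    refine ((h1.mul h2).mul h3).congr_deriv ?_
    simp only [Pi.mul_apply]
    have h4 := hx (NormedSpace.exp (s • B) *ᵥ v)
    have h5 : T (B *ᵥ NormedSpace.exp (s • B) *ᵥ v) =
      T (NormedSpace.exp (s • B) *ᵥ v) * x - x * T (NormedSpace.exp (s • B) *ᵥ v) := by
      rw [← neg_inj, ← h4, neg_sub]
    rw [h5]
    simp only [mul_sub, sub_mul, add_mul, mul_neg, neg_mul, mul_assoc]
    abel
  have hc := is_const_of_deriv_eq_zero (fun s => (hd s).differentiableAt)
    (fun s => (hd s).deriv) s 0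
  simp only [zero_smul, NormedSpace.exp_zero, one_mul, mul_one, Matrix.one_mulVec] at hc
  rw [← hc, smul_neg]
  simp only [mul_assoc, exp_neg_mul_exp', mul_one]
  rw [← mul_assoc, exp_neg_mul_exp', one_mul]

theorem hasDerivAt_exp_add_smul_apply (T : (Fin d → ℝ) →L[ℝ] 𝔸) {x : 𝔸}
    {B : Matrix (Fin d) (Fin d) ℝ} (hx : ∀ v, x * T v - T v * x = -T (B *ᵥ v)) (v : Fin d → ℝ) :
    HasDerivAt (fun ε : ℝ => NormedSpace.exp (x + ε • T v))
      (NormedSpace.exp x * T (phi (-B) *ᵥ v)) 0 := by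
  refine (hasDerivAt_exp_add_smul x (T v)).congr_deriv ?_
  simp only [exp_conj_apply T hx]
  have hc : Continuous fun s : ℝ => NormedSpace.exp (s • B) := continuous_exp'.comp (by fun_prop)
  rw [← integral_exp_smul, ← integral_mulVec_const hc,
    T.intervalIntegral_comp_comm ((hc.matrix_mulVec continuous_const).intervalIntegrable 0 1)]

/-- `T` is a representation, in a real Banach algebra, of the Lie algebra with structure constants
`f`. The convention `[T X, T v] = -T (F(θX) v)` is that of the exponent `T X = iθ X^j t_j` of
`ω(X)`; it is also satisfied by the real matrices `T X = -F(θX)`, the adjoint representation. -/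
def IsRep (f : Fin d → Fin d → Fin d → ℝ) (θ : ℝ) (T : (Fin d → ℝ) →L[ℝ] 𝔸) : Prop :=
  ∀ X v, T X * T v - T v * T X = -T (matF f (θ • X) *ᵥ v)

variable {f : Fin d → Fin d → Fin d → ℝ} {θ : ℝ}

/-- For a representation `T`, the derivative of `exp (T X)` in the direction `v` is
`exp (T X) T (phi (-F(θX)) v)`, where `phi (-F(θX))` is the transposed inverse vielbein. -/
theorem IsRep.hasFDerivAt_exp {T : (Fin d → ℝ) →L[ℝ] 𝔸} (hT : IsRep f θ T) (X : Fin d → ℝ) :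
    HasFDerivAt (fun Y => NormedSpace.exp (T Y))
      ((ContinuousLinearMap.mul ℝ 𝔸 (NormedSpace.exp (T X))).comp
        (T.comp (LinearMap.toContinuousLinearMap
          (Matrix.mulVecLin (phi (-matF f (θ • X))))))) X := by
  have hd : DifferentiableAt ℝ (fun Y => NormedSpace.exp (T Y)) X :=
    (contDiff_exp'.comp T.contDiff).differentiable (by norm_num) X
  convert hd.hasFDerivAt using 1
  ext1 v
  have h1 := (hasDerivAt_exp_add_smul_apply T (hT X) v)
  have h2 : HasLineDerivAt ℝ (fun Y => NormedSpace.exp (T Y)) _ X v :=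
    hd.hasFDerivAt.hasLineDerivAt v
  unfold HasLineDerivAt at h2
  simp only [map_add, map_smul] at h2
  exact h1.unique h2

end Representations

/-! ### Structure constants and the adjoint representation -/

section StructureConstants

variable {d : ℕ} {f : Fin d → Fin d → Fin d → ℝ} {θ : ℝ}

theorem matF_add (X Y : Fin d → ℝ) : matF f (X + Y) = matF f X + matF f Y := by
  ext a b
  simp [matF, mul_add, Finset.sum_add_distrib]

theorem matF_smul (c : ℝ) (X : Fin d → ℝ) : matF f (c • X) = c • matF f X := by
  ext a b
  simp [matF, Finset.mul_sum, mul_left_comm]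

theorem matF_zero : matF f 0 = 0 := by
  ext a b
  simp [matF]

theorem phi_transpose (A : Matrix (Fin d) (Fin d) ℝ) : phi Aᵀ = (phi A)ᵀ := by
  simp only [phi, Matrix.transpose_tsum, Matrix.transpose_smul, Matrix.transpose_pow,
    Matrix.transpose_neg]

theorem phi_zero : phi (0 : Matrix (Fin d) (Fin d) ℝ) = 1 := by
  rw [phi, tsum_eq_single 0]
  · simp
  · intro n hn
    simp [hn]

namespace IsStructureConstants

variable (hf : IsStructureConstants f)
include hf

theorem matF_transpose (X : Fin d → ℝ) : (matF f X)ᵀ = -matF f X := by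
  ext a b
  simp only [matF, Matrix.transpose_apply, Matrix.of_apply, Matrix.neg_apply,
    ← Finset.sum_neg_distrib]
  refine Finset.sum_congr rfl fun c _ => ?_
  rw [hf.antisymm_left c b a, hf.antisymm_right c a b, hf.antisymm_left a c b]
  ring

theorem matF_mulVec_comm (X v : Fin d → ℝ) : matF f X *ᵥ v = -(matF f v *ᵥ X) := by
  ext a
  simp only [matF, Matrix.mulVec, dotProduct, Matrix.of_apply, Pi.neg_apply,
    ← Finset.sum_neg_distrib, Finset.sum_mul]
  rw [Finset.sum_comm]
  refine Finset.sum_congr rfl fun c _ => Finset.sum_congr rfl fun b _ => ?_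
  rw [hf.antisymm_right a b c]
  ring

theorem matF_apply_self (X : Fin d → ℝ) (a : Fin d) : matF f X a a = 0 := by
  have := congrFun (congrFun (hf.matF_transpose X) a) a
  simp only [Matrix.transpose_apply, Matrix.neg_apply] at this
  linarith

theorem dotProduct_matF_mulVec (X u v : Fin d → ℝ) :
    u ⬝ᵥ (matF f X *ᵥ v) = -((matF f X *ᵥ u) ⬝ᵥ v) := by
  rw [Matrix.dotProduct_mulVec, ← Matrix.mulVec_transpose, hf.matF_transpose, Matrix.neg_mulVec,
    neg_dotProduct]

/-- The Jacobi identity in matrix form: `F` is the adjoint representation. -/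
theorem matF_mul_sub_mul (X Y : Fin d → ℝ) :
    matF f X * matF f Y - matF f Y * matF f X = matF f (matF f X *ᵥ Y) := by
  ext a b
  have h1 : ∀ X Y : Fin d → ℝ, (matF f X * matF f Y) a b =
      ∑ p, ∑ q, (∑ e, f a p e * f e q b) * (X p * Y q) := by
    intro X Y
    simp only [matF, Matrix.mul_apply, Matrix.of_apply, Finset.sum_mul, Finset.mul_sum]
    rw [Finset.sum_comm]
    conv_rhs => rw [Finset.sum_comm]
    refine Finset.sum_congr rfl fun q _ => ?_
    rw [Finset.sum_comm]
    exact Finset.sum_congr rfl fun p _ => Finset.sum_congr rfl fun e _ => by ring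
  have h2 : matF f (matF f X *ᵥ Y) a b =
      ∑ p, ∑ q, (∑ e, f a e b * f e p q) * (X p * Y q) := by
    simp only [matF, Matrix.mulVec, dotProduct, Matrix.of_apply, Finset.sum_mul, Finset.mul_sum]
    rw [Finset.sum_comm]
    conv_rhs => rw [Finset.sum_comm]
    refine Finset.sum_congr rfl fun q _ => ?_
    rw [Finset.sum_comm]
    exact Finset.sum_congr rfl fun p _ => Finset.sum_congr rfl fun e _ => by ring
  have h3 : (matF f Y * matF f X) a b =
      ∑ p, ∑ q, (∑ e, f a q e * f e p b) * (X p * Y q) := by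
    rw [h1, Finset.sum_comm]
    exact Finset.sum_congr rfl fun p _ => Finset.sum_congr rfl fun q _ => by ring
  rw [Matrix.sub_apply, h1, h2, h3, ← Finset.sum_sub_distrib]
  refine Finset.sum_congr rfl fun p _ => ?_
  rw [← Finset.sum_sub_distrib]
  refine Finset.sum_congr rfl fun q _ => ?_
  rw [← sub_mul, ← Finset.sum_sub_distrib]
  congr 1
  rw [← sub_eq_zero, ← Finset.sum_sub_distrib, ← hf.jacobi a p q b]
  refine Finset.sum_congr rfl fun e _ => ?_
  rw [hf.antisymm_left a q e, hf.antisymm_left a e b, hf.antisymm_right p e q,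
    hf.antisymm_left p e q]
  ring

theorem invVielbein_eq_transpose (X : Fin d → ℝ) :
    invVielbein f θ X = (phi (-matF f (θ • X)))ᵀ := by
  rw [← phi_transpose, Matrix.transpose_neg, hf.matF_transpose, neg_neg, invVielbein]

end IsStructureConstants
end StructureConstants

/-! ### The Maurer–Cartan equation -/

section MaurerCartan
attribute [local instance] Matrix.linftyOpNormedAddCommGroup Matrix.linftyOpNormedSpace
  Matrix.linftyOpNormedRing Matrix.linftyOpNormedAlgebra

variable {d : ℕ} {𝔸 : Type*} [NormedRing 𝔸] [NormedAlgebra ℝ 𝔸] [CompleteSpace 𝔸]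
variable {f : Fin d → Fin d → Fin d → ℝ} {θ : ℝ}

/-- A vector annihilated by `A` is fixed by `phi A`. -/
theorem phi_mulVec_of_mulVec_eq_zero {A : Matrix (Fin d) (Fin d) ℝ} {u : Fin d → ℝ}
    (h : A *ᵥ u = 0) : phi A *ᵥ u = u := by
  have h1 : HasSum (fun n : ℕ => ((((n + 1).factorial : ℝ)⁻¹) • (-A) ^ n) *ᵥ u) (phi A *ᵥ u) :=
    (hasSum_phi A).mapL (mulVecCLM u)
  refine h1.unique ?_
  have h2 := hasSum_single (f := fun n : ℕ => ((((n + 1).factorial : ℝ)⁻¹) • (-A) ^ n) *ᵥ u) 0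
    (fun n hn => by
      obtain ⟨m, rfl⟩ := Nat.exists_eq_succ_of_ne_zero hn
      simp only [Matrix.smul_mulVec, Nat.succ_eq_add_one, pow_succ, ← Matrix.mulVec_mulVec,
        Matrix.neg_mulVec, h, neg_zero, Matrix.mulVec_zero, smul_zero])
  simpa using h2

/-- The adjoint representation, normalized so as to satisfy `IsRep`. -/
def adjointRep (f : Fin d → Fin d → Fin d → ℝ) (θ : ℝ) :
    (Fin d → ℝ) →L[ℝ] Matrix (Fin d) (Fin d) ℝ :=
  LinearMap.toContinuousLinearMap
    { toFun := fun X => -matF f (θ • X)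
      map_add' := fun X Y => by rw [smul_add, matF_add, neg_add]
      map_smul' := fun c X => by rw [smul_comm, matF_smul, smul_neg, RingHom.id_apply] }

theorem adjointRep_apply (X : Fin d → ℝ) : adjointRep f θ X = -matF f (θ • X) := rfl

theorem IsStructureConstants.isRep_adjointRep (hf : IsStructureConstants f) :
    IsRep f θ (adjointRep f θ) := by
  intro X v
  change -matF f (θ • X) * -matF f (θ • v) - -matF f (θ • v) * -matF f (θ • X) =
    - -matF f (θ • (matF f (θ • X) *ᵥ v))
  simp only [neg_mul_neg, neg_neg]
  rw [hf.matF_mul_sub_mul, Matrix.mulVec_smul]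

theorem contDiff_phi_neg_matF :
    ContDiff ℝ 2 (fun X : Fin d → ℝ => phi (-matF f (θ • X))) :=
  contDiff_phi.comp (adjointRep f θ).contDiff

/-- The image of the Maurer–Cartan equation under a representation `T`: it expresses the symmetry
of the second derivative of `exp (T X)`. -/
theorem IsRep.map_maurerCartan {T : (Fin d → ℝ) →L[ℝ] 𝔸} (hT : IsRep f θ T) (X v w : Fin d → ℝ) :
    let Ψ := fun X : Fin d → ℝ => phi (-matF f (θ • X))
    T ((fderiv ℝ Ψ X w *ᵥ v) - (fderiv ℝ Ψ X v *ᵥ w)) =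
      T (matF f (θ • (Ψ X *ᵥ w)) *ᵥ (Ψ X *ᵥ v)) := by
  intro Ψ
  set F : (Fin d → ℝ) → 𝔸 := fun Y => NormedSpace.exp (T Y) with hF
  have hFc : ContDiff ℝ 2 F := contDiff_exp'.comp T.contDiff
  have hF1 : ∀ Y v, fderiv ℝ F Y v = F Y * T (Ψ Y *ᵥ v) := fun Y v => by
    rw [(hT.hasFDerivAt_exp Y).fderiv]
    rfl
  have hd : DifferentiableAt ℝ (fderiv ℝ F) X :=
    (hFc.fderiv_right (m := 1) (by norm_num)).differentiable (by norm_num) X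
  have hΨ : DifferentiableAt ℝ Ψ X :=
    (contDiff_phi_neg_matF (f := f) (θ := θ)).differentiable (by norm_num) X
  have hF2 : ∀ w v, fderiv ℝ (fderiv ℝ F) X w v =
      F X * T (Ψ X *ᵥ w) * T (Ψ X *ᵥ v) + F X * T (fderiv ℝ Ψ X w *ᵥ v) := by
    intro w v
    have h1 : HasLineDerivAt ℝ (fun Y => fderiv ℝ F Y v) (fderiv ℝ (fderiv ℝ F) X w v) X w :=
      ((ContinuousLinearMap.apply ℝ 𝔸 v).hasFDerivAt.comp X hd.hasFDerivAt).hasLineDerivAt w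
    have h2 : HasLineDerivAt ℝ F (F X * T (Ψ X *ᵥ w)) X w := by
      rw [← hF1]
      exact (hFc.differentiable (by norm_num) X).hasFDerivAt.hasLineDerivAt w
    have h3 : HasLineDerivAt ℝ (fun Y => T (Ψ Y *ᵥ v)) (T (fderiv ℝ Ψ X w *ᵥ v)) X w :=
      ((T.comp (mulVecCLM v)).hasFDerivAt.comp X hΨ.hasFDerivAt).hasLineDerivAt w
    have h4 := HasDerivAt.mul h2 h3
    simp only [hF1] at h1
    have h5 := HasDerivAt.unique h1 h4
    rw [h5]
    simp
  have hs := (hFc.contDiffAt (x := X)).isSymmSndFDerivAt (by simp) w v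
  rw [hF2, hF2, mul_assoc, mul_assoc, ← mul_add, ← mul_add] at hs
  have hs2 := congrArg (NormedSpace.exp (-(T X)) * ·) hs
  simp only [hF, ← mul_assoc, exp_neg_mul_exp', one_mul] at hs2
  have h6 := hT (Ψ X *ᵥ w) (Ψ X *ᵥ v)
  rw [map_sub, ← neg_eq_iff_eq_neg.2 h6, neg_sub, sub_eq_sub_iff_add_eq_add]
  rw [add_comm, hs2, add_comm]

/-- The Maurer–Cartan equation `∂_w (Ψ v) - ∂_v (Ψ w) = [Ψ w, Ψ v]` for the transposed inverse
vielbein `Ψ`. In the adjoint representation it holds up to a vector `z` of the centre, and `z = 0`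
since `Ψ` is trivial along the centre. -/
theorem IsStructureConstants.maurerCartan (hf : IsStructureConstants f) (X v w : Fin d → ℝ) :
    let Ψ := fun X : Fin d → ℝ => phi (-matF f (θ • X))
    (fderiv ℝ Ψ X w *ᵥ v) - (fderiv ℝ Ψ X v *ᵥ w) =
      matF f (θ • (Ψ X *ᵥ w)) *ᵥ (Ψ X *ᵥ v) := by
  intro Ψ
  have hΨ : DifferentiableAt ℝ Ψ X :=
    (contDiff_phi_neg_matF (f := f) (θ := θ)).differentiable (by norm_num) X
  have h : -matF f (θ • ((fderiv ℝ Ψ X w *ᵥ v) - (fderiv ℝ Ψ X v *ᵥ w))) =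
      -matF f (θ • (matF f (θ • (Ψ X *ᵥ w)) *ᵥ (Ψ X *ᵥ v))) :=
    (hf.isRep_adjointRep (θ := θ)).map_maurerCartan X v w
  set z := (fderiv ℝ Ψ X w *ᵥ v) - (fderiv ℝ Ψ X v *ᵥ w) -
    matF f (θ • (Ψ X *ᵥ w)) *ᵥ (Ψ X *ᵥ v) with hz
  -- `z` is central, as `ad z = 0`.
  have hz1 : matF f (θ • z) = 0 := by
    rw [hz, smul_sub, sub_eq_add_neg, matF_add, neg_inj.1 h, ← matF_add]
    simp [matF_zero]
  have hz0 : ∀ Y, matF f (θ • Y) *ᵥ z = 0 := fun Y => by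
    rw [matF_smul, Matrix.smul_mulVec, hf.matF_mulVec_comm, smul_neg, ← Matrix.smul_mulVec,
      ← matF_smul, hz1]
    simp
  -- The central component of `Ψ Y v` does not depend on `Y`, so its derivative vanishes.
  have h1 : ∀ Y v, z ⬝ᵥ (Ψ Y *ᵥ v) = z ⬝ᵥ v := fun Y v => by
    rw [Matrix.dotProduct_mulVec, ← Matrix.mulVec_transpose, ← hf.invVielbein_eq_transpose,
      invVielbein, phi_mulVec_of_mulVec_eq_zero (hz0 Y)]
  have h2 : ∀ w v, z ⬝ᵥ (fderiv ℝ Ψ X w *ᵥ v) = 0 := fun w v => by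
    let L : Matrix (Fin d) (Fin d) ℝ →L[ℝ] ℝ :=
      (LinearMap.toContinuousLinearMap (dotProductBilin ℝ ℝ z)).comp (mulVecCLM v)
    have h3 : HasFDerivAt (fun Y => z ⬝ᵥ (Ψ Y *ᵥ v)) (L.comp (fderiv ℝ Ψ X)) X :=
      L.hasFDerivAt.comp X hΨ.hasFDerivAt
    simp only [h1] at h3
    have h4 := h3.unique (hasFDerivAt_const _ X)
    exact congrArg (fun l : (Fin d → ℝ) →L[ℝ] ℝ => l w) h4
  have h3 : z ⬝ᵥ z = 0 := by
    conv_lhs => rw [hz]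
    rw [dotProduct_sub, dotProduct_sub, h2, h2, hf.dotProduct_matF_mulVec, hz0]
    simp
  exact sub_eq_zero.1 (dotProduct_self_eq_zero.1 h3)

end MaurerCartan

/-! ### The left-invariant fields are divergence free -/

section Divergence
attribute [local instance] Matrix.linftyOpNormedAddCommGroup Matrix.linftyOpNormedSpace
  Matrix.linftyOpNormedRing Matrix.linftyOpNormedAlgebra

variable {d : ℕ} {f : Fin d → Fin d → Fin d → ℝ} {θ : ℝ}

variable {n : ℕ} {𝕜 : Type*} [NormedField 𝕜] [NormedAlgebra ℝ 𝕜]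

theorem _root_.HasDerivAt.matrix_apply {M : ℝ → Matrix (Fin n) (Fin n) 𝕜}
    {M' : Matrix (Fin n) (Fin n) 𝕜} {s : ℝ} (h : HasDerivAt M M' s) (i j : Fin n) :
    HasDerivAt (fun s => M s i j) (M' i j) s :=
  (ContinuousLinearMap.mk (Matrix.entryLinearMap ℝ 𝕜 i j)
    (continuous_id.matrix_elem i j)).hasFDerivAt.comp_hasDerivAt s h

/-- Jacobi's formula for the derivative of a determinant. -/
theorem _root_.HasDerivAt.matrix_det {M : ℝ → Matrix (Fin d) (Fin d) ℝ}
    {M' : Matrix (Fin d) (Fin d) ℝ} {s : ℝ} (h : HasDerivAt M M' s) :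
    HasDerivAt (fun s => (M s).det) ((M s).adjugate * M').trace s := by
  have h1 : HasDerivAt (fun s => (M s).det) (∑ σ : Equiv.Perm (Fin d),
      ((Equiv.Perm.sign σ : ℤ) : ℝ) * ∑ i, (∏ k ∈ Finset.univ.erase i, M s (σ k) k) •
        M' (σ i) i) s := by
    simp only [Matrix.det_apply']
    exact HasDerivAt.fun_sum fun σ _ => (HasDerivAt.fun_finsetProd fun i _ =>
      h.matrix_apply (σ i) i).const_mul _
  refine h1.congr_deriv ?_
  simp only [Finset.mul_sum]
  rw [Finset.sum_comm]
  refine Finset.sum_congr rfl fun i _ => ?_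
  have h2 : ((M s).adjugate * M') i i = ((M s).updateCol i fun k => M' k i).det := by
    rw [← Matrix.cramer_apply, Matrix.cramer_eq_adjugate_mulVec]
    rfl
  rw [Matrix.diag_apply, h2, Matrix.det_apply']
  refine Finset.sum_congr rfl fun σ _ => ?_
  rw [← Finset.mul_prod_erase Finset.univ _ (Finset.mem_univ i), Matrix.updateCol_self,
    smul_eq_mul, mul_comm (M' _ _)]
  congr 2
  refine Finset.prod_congr rfl fun k hk => ?_
  rw [Matrix.updateCol_ne (Finset.ne_of_mem_erase hk)]

theorem hasFDerivAt_matrix_inv [FiniteDimensional ℝ 𝕜] {M : Matrix (Fin n) (Fin n) 𝕜}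
    (hM : IsUnit M.det) :
    HasFDerivAt (fun N : Matrix (Fin n) (Fin n) 𝕜 => N⁻¹)
      (-ContinuousLinearMap.mulLeftRight ℝ (Matrix (Fin n) (Fin n) 𝕜) M⁻¹ M⁻¹) M := by
  obtain ⟨u, rfl⟩ := (Matrix.isUnit_iff_isUnit_det M).2 hM
  have : CompleteSpace (Matrix (Fin n) (Fin n) 𝕜) :=
    FiniteDimensional.complete ℝ _
  have := hasFDerivAt_ringInverse (𝕜 := ℝ) u
  rw [← Ring.inverse_unit, ← Matrix.nonsing_inv_eq_ringInverse] at this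
  refine this.congr_of_eventuallyEq (Filter.Eventually.of_forall fun N => ?_)
  exact Matrix.nonsing_inv_eq_ringInverse N

theorem _root_.HasDerivAt.matrix_inv [FiniteDimensional ℝ 𝕜] {M : ℝ → Matrix (Fin n) (Fin n) 𝕜}
    {M' : Matrix (Fin n) (Fin n) 𝕜} {s : ℝ} (h : HasDerivAt M M' s) (hM : IsUnit (M s).det) :
    HasDerivAt (fun s => (M s)⁻¹) (-((M s)⁻¹ * M' * (M s)⁻¹)) s :=
  (hasFDerivAt_matrix_inv hM).comp_hasDerivAt s h

theorem contDiff_invVielbein : ContDiff ℝ 2 (invVielbein f θ) := by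
  have h : invVielbein f θ = fun X => phi (-(adjointRep f θ X)) := by
    funext X
    rw [adjointRep_apply, neg_neg, invVielbein]
  rw [h]
  exact contDiff_phi.comp (adjointRep f θ).contDiff.neg

theorem differentiable_det_invVielbein :
    Differentiable ℝ (fun X => (invVielbein f θ X).det) := by
  have h : ContDiff ℝ 1 fun X => (invVielbein f θ X).det := by
    simp only [Matrix.det_apply']
    refine ContDiff.sum fun σ _ => contDiff_const.mul (contDiff_prod fun i _ => ?_)
    exact (LinearMap.toContinuousLinearMap
      (Matrix.entryLinearMap ℝ ℝ (σ i) i)).contDiff.comp (contDiff_invVielbein.of_le (by norm_num))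
  exact h.differentiable (by norm_num)

theorem differentiableAt_vielbein {X : Fin d → ℝ} (hX : X ∈ regularSet f θ) :
    DifferentiableAt ℝ (vielbein f θ) X :=
  ((hasFDerivAt_matrix_inv hX).comp X
    ((contDiff_invVielbein.differentiable (by norm_num)) X).hasFDerivAt).differentiableAt

theorem differentiableAt_vielbein_apply {X : Fin d → ℝ} (hX : X ∈ regularSet f θ) (a j : Fin d) :
    DifferentiableAt ℝ (fun Y => vielbein f θ Y a j) X :=
  (LinearMap.toContinuousLinearMap (Matrix.entryLinearMap ℝ ℝ a j)).differentiableAt.comp X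
    (differentiableAt_vielbein hX)

theorem hasLineDerivAt_det_mul_vielbein {X : Fin d → ℝ} (hX : X ∈ regularSet f θ)
    {M' : Matrix (Fin d) (Fin d) ℝ} {w : Fin d → ℝ}
    (h : HasDerivAt (fun s : ℝ => invVielbein f θ (X + s • w)) M' 0) (a j : Fin d) :
    HasLineDerivAt ℝ (fun Y => (invVielbein f θ Y).det * vielbein f θ Y a j)
      ((invVielbein f θ X).det * ((vielbein f θ X * M').trace * vielbein f θ X a j -
        (vielbein f θ X * M' * vielbein f θ X) a j)) X w := by
  have hX' : IsUnit (invVielbein f θ X).det := hX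
  have h0 : X + (0 : ℝ) • w = X := by simp
  have h1 := h.matrix_det
  have h2 := (h.matrix_inv (by rwa [h0])).matrix_apply a j
  rw [h0] at h1 h2
  have hadj : (invVielbein f θ X).adjugate = (invVielbein f θ X).det • vielbein f θ X := by
    rw [vielbein, Matrix.inv_def, smul_smul, Ring.mul_inverse_cancel _ hX', one_smul]
  refine (h1.fun_mul h2).congr_deriv ?_
  rw [hadj, Matrix.smul_mul, Matrix.trace_smul, h0, smul_eq_mul, Matrix.neg_apply]
  simp only [vielbein]
  ring

theorem sum_smul_apply_single {E : Type*} [AddCommGroup E] [Module ℝ E] [TopologicalSpace E]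
    (L : (Fin d → ℝ) →L[ℝ] E) (w : Fin d → ℝ) :
    ∑ j, w j • L (Pi.single j 1) = L w := by
  conv_rhs => rw [← Finset.univ_sum_single w]
  rw [map_sum]
  refine Finset.sum_congr rfl fun j _ => ?_
  rw [← map_smul, ← Pi.single_smul, smul_eq_mul, mul_one]

/-- The fields `D_a` are divergence free: `∂_j (det E · E_a^j) = 0`. By the Maurer–Cartan equation
the left-hand side is `det E` times the trace of `F(θ e_a)`, which is antisymmetric. -/
theorem IsStructureConstants.sum_lineDeriv_det_mul_vielbein (hf : IsStructureConstants f)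
    {X : Fin d → ℝ} (hX : X ∈ regularSet f θ) (a : Fin d) :
    ∑ j, lineDeriv ℝ (fun Y => (invVielbein f θ Y).det * vielbein f θ Y a j) X
      (Pi.single j 1) = 0 := by
  have hX' : IsUnit (invVielbein f θ X).det := hX
  set Ψ := fun X : Fin d → ℝ => phi (-matF f (θ • X))
  have hΨ : DifferentiableAt ℝ Ψ X :=
    (contDiff_phi_neg_matF (f := f) (θ := θ)).differentiable (by norm_num) X
  set W := vielbein f θ X with hW
  have hM : ∀ w, HasDerivAt (fun s : ℝ => invVielbein f θ (X + s • w)) (fderiv ℝ Ψ X w)ᵀ 0 := by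
    intro w
    have h1 : HasDerivAt (fun s : ℝ => Ψ (X + s • w)) (fderiv ℝ Ψ X w) 0 :=
      hΨ.hasFDerivAt.hasLineDerivAt w
    simp only [hf.invVielbein_eq_transpose]
    exact (LinearMap.toContinuousLinearMap (Matrix.transposeLinearEquiv (Fin d) (Fin d) ℝ
      ℝ).toLinearMap).hasFDerivAt.comp_hasDerivAt 0 h1
  -- `Ψ` maps the `b`-th row of the vielbein to the `b`-th basis vector.
  have hΨW : ∀ b, Ψ X *ᵥ W b = Pi.single b 1 := fun b => by
    have h1 : W b ᵥ* invVielbein f θ X = Pi.single b 1 := by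
      have h2 : W * invVielbein f θ X = 1 := Matrix.nonsing_inv_mul _ hX'
      funext k
      have h3 := congrFun (congrFun h2 b) k
      rw [Matrix.one_apply] at h3
      rw [Pi.single_apply]
      simp only [eq_comm (a := k)]
      exact h3
    rw [← h1, hf.invVielbein_eq_transpose, Matrix.vecMul_transpose]
  have h1 : ∀ v u : Fin d → ℝ, ∀ b, (fderiv ℝ Ψ X v *ᵥ u) b =
      ∑ j, v j * (fderiv ℝ Ψ X (Pi.single j 1) *ᵥ u) b := by
    intro v u b
    have := sum_smul_apply_single
      ((ContinuousLinearMap.proj (R := ℝ) (φ := fun _ => ℝ) b).comp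
        ((mulVecCLM u).comp (fderiv ℝ Ψ X))) v
    exact this.symm
  have h2 : ∀ j, (W * (fderiv ℝ Ψ X (Pi.single j 1))ᵀ).trace =
      ∑ b, (fderiv ℝ Ψ X (Pi.single j 1) *ᵥ W b) b := by
    intro j
    refine Finset.sum_congr rfl fun b _ => ?_
    change ∑ k, W b k * fderiv ℝ Ψ X (Pi.single j 1) b k =
      ∑ k, fderiv ℝ Ψ X (Pi.single j 1) b k * W b k
    exact Finset.sum_congr rfl fun k _ => mul_comm _ _
  have h3 : ∀ j, (W * (fderiv ℝ Ψ X (Pi.single j 1))ᵀ * W) a j =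
      ∑ b, W b j * (fderiv ℝ Ψ X (Pi.single j 1) *ᵥ W a) b := by
    intro j
    rw [Matrix.mul_apply]
    refine Finset.sum_congr rfl fun b _ => ?_
    rw [mul_comm]
    congr 1
    change ∑ k, W a k * fderiv ℝ Ψ X (Pi.single j 1) b k =
      ∑ k, fderiv ℝ Ψ X (Pi.single j 1) b k * W a k
    exact Finset.sum_congr rfl fun k _ => mul_comm _ _
  simp only [fun j => (hasLineDerivAt_det_mul_vielbein hX (hM (Pi.single j 1)) a j).lineDeriv,
    ← hW, h2, h3]
  rw [← Finset.mul_sum, Finset.sum_sub_distrib]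
  simp only [Finset.sum_mul]
  rw [Finset.sum_comm, Finset.sum_comm (f := fun j b => W b j * _), ← Finset.sum_sub_distrib]
  rw [Finset.sum_eq_zero, mul_zero]
  intro b _
  have h4 : ∑ j, (fderiv ℝ Ψ X (Pi.single j 1) *ᵥ W b) b * W a j =
      (fderiv ℝ Ψ X (W a) *ᵥ W b) b := by
    rw [h1 (W a)]
    exact Finset.sum_congr rfl fun j _ => mul_comm _ _
  rw [h4, ← h1 (W b), ← Pi.sub_apply, hf.maurerCartan X (W b) (W a)]
  change (matF f (θ • (Ψ X *ᵥ W a)) *ᵥ (Ψ X *ᵥ W b)) b = 0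
  rw [hΨW, hΨW, Matrix.mulVec_single_one]
  exact hf.matF_apply_self _ b

end Divergence

/-! ### The Laplace–Beltrami operator -/

section Laplacian

variable {d : ℕ} {f : Fin d → Fin d → Fin d → ℝ} {θ : ℝ}

theorem metric_eq_mul_transpose (X : Fin d → ℝ) :
    metric f θ X = invVielbein f θ X * (invVielbein f θ X)ᵀ := rfl

theorem sqrt_det_metric (X : Fin d → ℝ) : √(metric f θ X).det = |(invVielbein f θ X).det| := by
  rw [metric_eq_mul_transpose, Matrix.det_mul, Matrix.det_transpose, Real.sqrt_mul_self_eq_abs]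

theorem metric_inv_apply (X : Fin d → ℝ) (j k : Fin d) :
    (metric f θ X)⁻¹ j k = ∑ a, vielbein f θ X a j * vielbein f θ X a k := by
  rw [metric_eq_mul_transpose, Matrix.mul_inv_rev, ← Matrix.transpose_nonsing_inv]
  rfl

theorem differentiableAt_partialD {ψ : (Fin d → ℝ) → ℂ} {X : Fin d → ℝ}
    (hψ : ContDiffAt ℝ 2 ψ X) (k : Fin d) : DifferentiableAt ℝ (partialD k ψ) X := by
  have h1 : DifferentiableAt ℝ (fun Y => fderiv ℝ ψ Y (Pi.single k 1)) X :=
    ((hψ.fderiv_right (m := 1) (by norm_num)).differentiableAt (by norm_num)).clm_apply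
      (differentiableAt_const _)
  refine h1.congr_of_eventuallyEq ?_
  filter_upwards [hψ.eventually (by simp)] with Y hY
  exact (hY.differentiableAt (by norm_num)).lineDeriv_eq_fderiv

theorem differentiableAt_opD {ψ : (Fin d → ℝ) → ℂ} {X : Fin d → ℝ} (hX : X ∈ regularSet f θ)
    (hψ : ContDiffAt ℝ 2 ψ X) (a : Fin d) : DifferentiableAt ℝ (opD f θ a ψ) X := by
  unfold opD
  refine DifferentiableAt.fun_sum fun j _ => ?_
  exact (Complex.ofRealCLM.differentiableAt.comp X (differentiableAt_vielbein_apply hX a j)).mul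
    (differentiableAt_partialD hψ j)

/-- On the regular set `√g = |det E|`, which agrees with `det E` locally up to a constant sign. -/
theorem exists_sqrt_det_metric_eventuallyEq {X : Fin d → ℝ} (hX : X ∈ regularSet f θ) :
    ∃ σ : ℝ, σ ≠ 0 ∧ ∀ᶠ Y in 𝓝 X, √(metric f θ Y).det = σ * (invVielbein f θ Y).det := by
  have hc : ContinuousAt (fun Y => (invVielbein f θ Y).det) X :=
    differentiable_det_invVielbein.continuous.continuousAt
  rcases lt_or_gt_of_ne (IsUnit.ne_zero hX : (invVielbein f θ X).det ≠ 0) with h | h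
  · refine ⟨-1, by norm_num, ?_⟩
    filter_upwards [hc.eventually_lt_const h] with Y hY
    rw [sqrt_det_metric, abs_of_neg hY, neg_one_mul]
  · refine ⟨1, by norm_num, ?_⟩
    filter_upwards [hc.eventually_const_lt h] with Y hY
    rw [sqrt_det_metric, abs_of_pos hY, one_mul]

/-- Since `√g g^{jk} ∂_k ψ = √g E_a^j D_a ψ`, the product rule splits the Laplacian into `D_a D_a ψ`
and a multiple of the divergence of `D_a`. -/
theorem IsStructureConstants.hamiltonian_eq (hf : IsStructureConstants f)
    {X : Fin d → ℝ} (hX : X ∈ regularSet f θ) {ψ : (Fin d → ℝ) → ℂ} (hψ : ContDiffAt ℝ 2 ψ X) :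
    hamiltonian f θ ψ X = -(1 / 2) * laplaceBeltrami (metric f θ) ψ X := by
  obtain ⟨σ, hσ, hev⟩ := exists_sqrt_det_metric_eventuallyEq hX
  rw [hamiltonian, laplaceBeltrami]
  congr 1
  set G : Fin d → Fin d → (Fin d → ℝ) → ℝ :=
    fun a j Y => (invVielbein f θ Y).det * vielbein f θ Y a j with hG
  have hGd : ∀ a j, DifferentiableAt ℝ (G a j) X := fun a j =>
    (differentiable_det_invVielbein X).mul (differentiableAt_vielbein_apply hX a j)
  have h1 : ∀ j, partialD j (fun Y => ∑ k,
      ((√(metric f θ Y).det * (metric f θ Y)⁻¹ j k : ℝ) : ℂ) * partialD k ψ Y) X =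
      σ * ∑ a, (((lineDeriv ℝ (G a j) X (Pi.single j 1) : ℝ) : ℂ) * opD f θ a ψ X +
        G a j X * partialD j (opD f θ a ψ) X) := by
    intro j
    have h2 : (fun Y => ∑ k,
        ((√(metric f θ Y).det * (metric f θ Y)⁻¹ j k : ℝ) : ℂ) * partialD k ψ Y) =ᶠ[𝓝 X]
        fun Y => σ * ∑ a, (G a j Y : ℂ) * opD f θ a ψ Y := by
      filter_upwards [hev] with Y hY
      simp only [hY, metric_inv_apply, hG, opD]
      push_cast
      simp only [Finset.mul_sum, Finset.sum_mul]
      rw [Finset.sum_comm]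
      exact Finset.sum_congr rfl fun a _ => Finset.sum_congr rfl fun k _ => by ring
    rw [partialD, h2.lineDeriv_eq]
    refine HasLineDerivAt.lineDeriv ?_
    refine HasDerivAt.const_mul _ (HasDerivAt.fun_sum fun a _ => ?_)
    have h3 : HasLineDerivAt ℝ (G a j) _ X (Pi.single j 1) :=
      ((hGd a j).lineDifferentiableAt).hasLineDerivAt
    have h4 : HasLineDerivAt ℝ (opD f θ a ψ) (partialD j (opD f θ a ψ) X) X (Pi.single j 1) :=
      ((differentiableAt_opD hX hψ a).lineDifferentiableAt).hasLineDerivAt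
    have h5 := (HasDerivAt.ofReal_comp h3).fun_mul h4
    simpa using h5
  simp only [h1]
  rw [hev.self_of_nhds, ← Finset.mul_sum, Finset.sum_comm]
  simp only [Finset.sum_add_distrib, ← Finset.sum_mul]
  have h6 : ∀ a, ∑ j, ((lineDeriv ℝ (G a j) X (Pi.single j 1) : ℝ) : ℂ) = 0 := fun a => by
    exact_mod_cast hf.sum_lineDeriv_det_mul_vielbein hX a
  have h7 : ((invVielbein f θ X).det : ℂ) ≠ 0 := by
    exact_mod_cast (IsUnit.ne_zero hX : (invVielbein f θ X).det ≠ 0)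
  have h8 : ∀ a, ∑ j, (G a j X : ℂ) * partialD j (opD f θ a ψ) X =
      (invVielbein f θ X).det * opD f θ a (opD f θ a ψ) X := fun a => by
    rw [opD, Finset.mul_sum]
    refine Finset.sum_congr rfl fun j _ => ?_
    simp only [hG]
    push_cast
    ring
  have h9 : (σ : ℂ) ≠ 0 := by exact_mod_cast hσ
  simp only [h6, h8, zero_mul, Finset.sum_const_zero, zero_add]
  rw [← Finset.mul_sum]
  push_cast
  field_simp

end Laplacian

/-! ### Bi-invariance and the trace formula -/

section BiInvariance
attribute [local instance] Matrix.linftyOpNormedAddCommGroup Matrix.linftyOpNormedSpace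
  Matrix.linftyOpNormedRing Matrix.linftyOpNormedAlgebra

variable {d N : ℕ} {f : Fin d → Fin d → Fin d → ℝ} {θ : ℝ}
  {t : Fin d → Matrix (Fin N) (Fin N) ℂ}

/-- The exponent `iθ X^j t_j` of `ω(X)`, as a real linear map. -/
def omegaExponent (t : Fin d → Matrix (Fin N) (Fin N) ℂ) (θ : ℝ) :
    (Fin d → ℝ) →L[ℝ] Matrix (Fin N) (Fin N) ℂ :=
  LinearMap.toContinuousLinearMap
    { toFun := fun X => (Complex.I * (θ : ℂ)) • ∑ j, (X j : ℂ) • t j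
      map_add' := fun X Y => by
        simp only [Pi.add_apply, Complex.ofReal_add, add_smul, Finset.sum_add_distrib, smul_add]
      map_smul' := fun c X => by
        simp only [Pi.smul_apply, smul_eq_mul, Complex.ofReal_mul, mul_smul, RingHom.id_apply,
          ← Finset.smul_sum, Complex.coe_smul]
        rw [smul_comm c, smul_comm c] }

theorem omegaExponent_apply (X : Fin d → ℝ) :
    omegaExponent t θ X = (Complex.I * (θ : ℂ)) • ∑ j, (X j : ℂ) • t j := rfl

theorem IsRepresentation.sum_smul_mul_sub (hf : IsStructureConstants f)
    (ht : IsRepresentation f t) (X v : Fin d → ℝ) :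
    (∑ j, (X j : ℂ) • t j) * (∑ j, (v j : ℂ) • t j) -
      (∑ j, (v j : ℂ) • t j) * (∑ j, (X j : ℂ) • t j) =
      Complex.I • ∑ c, ((matF f X *ᵥ v) c : ℂ) • t c := by
  rw [Finset.sum_mul_sum, Finset.sum_mul_sum, Finset.sum_comm (f := fun i j => (v i : ℂ) • t i * _),
    ← Finset.sum_sub_distrib]
  have h1 : ∀ a b, (X a : ℂ) • t a * (v b : ℂ) • t b - (v b : ℂ) • t b * (X a : ℂ) • t a =
      Complex.I • ∑ c, ((f a b c * X a * v b : ℝ) : ℂ) • t c := by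
    intro a b
    rw [smul_mul_smul_comm, smul_mul_smul_comm, mul_comm (v b : ℂ), ← smul_sub, ht a b, smul_comm,
      Finset.smul_sum]
    congr 1
    refine Finset.sum_congr rfl fun c _ => ?_
    rw [smul_smul]
    congr 1
    push_cast
    ring
  simp only [← Finset.sum_sub_distrib, h1, ← Finset.smul_sum]
  congr 1
  have h2 : ∀ c, (((matF f X *ᵥ v) c : ℝ) : ℂ) • t c =
      ∑ a, ∑ b, ((f a b c * X a * v b : ℝ) : ℂ) • t c := by
    intro c
    simp only [← Finset.sum_smul, ← Complex.ofReal_sum]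
    congr 2
    simp only [matF, Matrix.mulVec, dotProduct, Matrix.of_apply, Finset.sum_mul]
    rw [Finset.sum_comm]
    refine Finset.sum_congr rfl fun a _ => Finset.sum_congr rfl fun b _ => ?_
    rw [hf.antisymm_left a c b, hf.antisymm_right a b c]
    ring
  simp only [h2]
  conv_rhs => rw [Finset.sum_comm]
  exact Finset.sum_congr rfl fun a _ => Finset.sum_comm

theorem IsRepresentation.isRep (hf : IsStructureConstants f) (ht : IsRepresentation f t) :
    IsRep f θ (omegaExponent t θ) := by
  intro X v
  have h := ht.sum_smul_mul_sub hf X v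
  change (Complex.I * (θ : ℂ)) • (∑ j, (X j : ℂ) • t j) *
      (Complex.I * (θ : ℂ)) • (∑ j, (v j : ℂ) • t j) -
      (Complex.I * (θ : ℂ)) • (∑ j, (v j : ℂ) • t j) *
      (Complex.I * (θ : ℂ)) • (∑ j, (X j : ℂ) • t j) =
      -((Complex.I * (θ : ℂ)) • ∑ j, ((matF f (θ • X) *ᵥ v) j : ℂ) • t j)
  rw [smul_mul_smul_comm, smul_mul_smul_comm, ← smul_sub, h, matF_smul, Matrix.smul_mulVec]
  simp only [Pi.smul_apply, smul_eq_mul, Complex.ofReal_mul, mul_smul, ← Finset.smul_sum]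
  simp only [smul_smul, ← neg_smul]
  congr 1
  linear_combination (θ : ℂ) ^ 2 * Complex.I * Complex.I_sq

theorem omega_eq (X : Fin d → ℝ) : omega t θ X = NormedSpace.exp (omegaExponent t θ X) := rfl

theorem IsRepresentation.hasFDerivAt_omega (hf : IsStructureConstants f)
    (ht : IsRepresentation f t) (X : Fin d → ℝ) :
    ∃ L : (Fin d → ℝ) →L[ℝ] Matrix (Fin N) (Fin N) ℂ, HasFDerivAt (omega t θ) L X ∧
      ∀ v, L v = omega t θ X * omegaExponent t θ (phi (-matF f (θ • X)) *ᵥ v) :=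
  ⟨_, (ht.isRep hf).hasFDerivAt_exp X, fun _ => rfl⟩

theorem injective_omegaExponent (hθ : θ ≠ 0) (ht : LinearIndependent ℝ t) :
    Function.Injective (omegaExponent t θ) := by
  intro X Y h
  have h1 : (∑ j, (X j : ℂ) • t j) = ∑ j, (Y j : ℂ) • t j := by
    have h0 : Complex.I * (θ : ℂ) ≠ 0 := by simp [hθ]
    exact smul_right_injective _ h0 h
  simp only [Complex.coe_smul] at h1
  funext j
  have h2 : ∑ j, (X j - Y j) • t j = 0 := by
    simp only [sub_smul, Finset.sum_sub_distrib, h1, sub_self]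
  exact sub_eq_zero.1 (Fintype.linearIndependent_iff.1 ht _ h2 j)

theorem IsStructureConstants.dotProduct_metric_mulVec (hf : IsStructureConstants f)
    (X v w : Fin d → ℝ) : v ⬝ᵥ (metric f θ X *ᵥ w) =
      (phi (-matF f (θ • X)) *ᵥ v) ⬝ᵥ (phi (-matF f (θ • X)) *ᵥ w) := by
  rw [metric_eq_mul_transpose, hf.invVielbein_eq_transpose, Matrix.transpose_transpose,
    ← Matrix.mulVec_mulVec, Matrix.dotProduct_mulVec, Matrix.vecMul_transpose]

/-- `exp (F(X))` is orthogonal. -/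
theorem IsStructureConstants.dotProduct_exp_matF (hf : IsStructureConstants f)
    (X v w : Fin d → ℝ) :
    (NormedSpace.exp (matF f X) *ᵥ v) ⬝ᵥ (NormedSpace.exp (matF f X) *ᵥ w) = v ⬝ᵥ w := by
  rw [Matrix.dotProduct_mulVec, ← Matrix.vecMul_transpose, Matrix.vecMul_vecMul,
    ← Matrix.exp_transpose, hf.matF_transpose]
  have h : NormedSpace.exp (-matF f X) * NormedSpace.exp (matF f X) = 1 := exp_neg_mul_exp' _
  rw [h, Matrix.vecMul_one]

/-- Differentiating `ω(Φ(Y)) = ω(U) ω(Y) ω(V)` relates the left-invariant forms at `Φ(X)` and `X`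
by the adjoint action of `ω(V)`, which is orthogonal. -/
theorem IsRepresentation.isBiInvariant (hf : IsStructureConstants f) (hθ : θ ≠ 0)
    (ht : IsRepresentation f t) (hli : LinearIndependent ℝ t) :
    IsBiInvariant (omega t θ) (metric f θ) := by
  intro U V X Φ hΦ hev
  have key : ∀ v, phi (-matF f (θ • Φ X)) *ᵥ (fderiv ℝ Φ X v) =
      NormedSpace.exp (matF f (θ • V)) *ᵥ (phi (-matF f (θ • X)) *ᵥ v) := by
    intro v
    obtain ⟨L, hL, hLv⟩ := ht.hasFDerivAt_omega (θ := θ) hf X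
    obtain ⟨L', hL', hLv'⟩ := ht.hasFDerivAt_omega (θ := θ) hf (Φ X)
    have h1 : HasLineDerivAt ℝ (fun Y => omega t θ (Φ Y)) (L' (fderiv ℝ Φ X v)) X v :=
      (hL'.comp X hΦ.hasFDerivAt).hasLineDerivAt v
    have h2 : HasLineDerivAt ℝ (fun Y => omega t θ U * omega t θ Y * omega t θ V)
        (omega t θ U * L v * omega t θ V) X v :=
      ((hL.hasLineDerivAt v).const_mul (omega t θ U)).mul_const (omega t θ V)
    have h3 : L' (fderiv ℝ Φ X v) = omega t θ U * L v * omega t θ V :=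
      HasDerivAt.unique h1 (h2.congr_of_eventuallyEq hev)
    rw [hLv, hLv', hev.self_of_nhds] at h3
    apply injective_omegaExponent hθ hli
    have hinv : ∀ Y, (omega t θ Y)⁻¹ * omega t θ Y = 1 := fun Y =>
      Matrix.nonsing_inv_mul _ ((Matrix.isUnit_iff_isUnit_det _).1 (Matrix.isUnit_exp _))
    have h4 : (omega t θ V)⁻¹ * omegaExponent t θ (phi (-matF f (θ • X)) *ᵥ v) * omega t θ V =
        omegaExponent t θ
          (NormedSpace.exp (matF f (θ • V)) *ᵥ (phi (-matF f (θ • X)) *ᵥ v)) := by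
      have h5 := exp_conj_apply (omegaExponent t θ) ((ht.isRep (θ := θ) hf) V)
        (phi (-matF f (θ • X)) *ᵥ v) 1
      simp only [one_smul] at h5
      rw [omega_eq, ← Matrix.exp_neg]
      exact h5
    rw [← h4]
    have h6 := congrArg (fun M => (omega t θ V)⁻¹ * ((omega t θ X)⁻¹ * ((omega t θ U)⁻¹ * M))) h3
    have hc : ∀ Y (M : Matrix (Fin N) (Fin N) ℂ), (omega t θ Y)⁻¹ * (omega t θ Y * M) = M :=
      fun Y M => by rw [← mul_assoc, hinv, one_mul]
    simp only [mul_assoc, hc] at h6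
    rw [h6, mul_assoc]
  intro v w
  rw [hf.dotProduct_metric_mulVec, hf.dotProduct_metric_mulVec, key, key, hf.dotProduct_exp_matF]

theorem IsStructureConstants.phi_mulVec_single (hf : IsStructureConstants f) (X : Fin d → ℝ)
    (j : Fin d) : phi (-matF f (θ • X)) *ᵥ Pi.single j 1 = invVielbein f θ X j := by
  rw [hf.invVielbein_eq_transpose, Matrix.mulVec_single_one]
  rfl

theorem IsRepresentation.matPartialD_omega (hf : IsStructureConstants f)
    (ht : IsRepresentation f t) (X : Fin d → ℝ) (j : Fin d) :
    matPartialD j (omega t θ) X = omega t θ X * omegaExponent t θ (invVielbein f θ X j) ∧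
    matPartialD j (fun Y => (omega t θ Y)⁻¹) X =
      -(omegaExponent t θ (invVielbein f θ X j) * (omega t θ X)⁻¹) := by
  obtain ⟨L, hL, hLv⟩ := ht.hasFDerivAt_omega (θ := θ) hf X
  have h1 : HasDerivAt (fun s : ℝ => omega t θ (X + s • Pi.single j 1))
      (omega t θ X * omegaExponent t θ (invVielbein f θ X j)) 0 := by
    rw [← hf.phi_mulVec_single, ← hLv]
    exact hL.hasLineDerivAt _
  have hu : ∀ Y, IsUnit (omega t θ Y).det := fun Y =>
    (Matrix.isUnit_iff_isUnit_det _).1 (Matrix.isUnit_exp _)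
  have h2 := h1.matrix_inv (hu _)
  constructor
  · ext m n
    exact (h1.matrix_apply m n).deriv
  · ext m n
    refine (h2.matrix_apply m n).deriv.trans ?_
    rw [zero_smul, add_zero, ← mul_assoc, Matrix.nonsing_inv_mul _ (hu X), one_mul]

theorem IsRepresentation.metric_apply_eq_trace (hf : IsStructureConstants f) (hθ : θ ≠ 0)
    (ht : IsRepresentation f t) {h : ℝ} (hh : h ≠ 0)
    (htr : ∀ a b, (t a * t b).trace = if a = b then (h : ℂ) else 0) (X : Fin d → ℝ)
    (j k : Fin d) :
    (metric f θ X j k : ℂ) = 1 / ((h : ℂ) * (θ : ℂ) ^ 2) *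
      (matPartialD j (fun Y => (omega t θ Y)⁻¹) X * matPartialD k (omega t θ) X).trace := by
  have hu : IsUnit (omega t θ X).det :=
    (Matrix.isUnit_iff_isUnit_det _).1 (Matrix.isUnit_exp _)
  rw [(ht.matPartialD_omega hf X j).2, (ht.matPartialD_omega hf X k).1, neg_mul, mul_assoc,
    ← mul_assoc (omega t θ X)⁻¹, Matrix.nonsing_inv_mul _ hu, one_mul, omegaExponent_apply,
    omegaExponent_apply, smul_mul_smul_comm, Finset.sum_mul_sum, Matrix.trace_neg,
    Matrix.trace_smul]
  simp only [Matrix.trace_sum, smul_mul_smul_comm, Matrix.trace_smul, htr, smul_eq_mul, mul_ite,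
    mul_zero, Finset.sum_ite_eq, Finset.mem_univ, if_true, metric, Matrix.of_apply]
  rw [← Finset.sum_mul]
  push_cast
  have h1 : (h : ℂ) ≠ 0 := by exact_mod_cast hh
  have h2 : (θ : ℂ) ≠ 0 := by exact_mod_cast hθ
  field_simp
  rw [Complex.I_sq]
  ring

end BiInvariance

theorem metric_zero {d : ℕ} (f : Fin d → Fin d → Fin d → ℝ) (θ : ℝ) : metric f θ 0 = 1 := by
  rw [metric_eq_mul_transpose, invVielbein, smul_zero, matF_zero, phi_zero, Matrix.transpose_one,
    mul_one]

end GroupHamiltonian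

end

theorem theorem2 {d : ℕ} (f : Fin d → Fin d → Fin d → ℝ)
    (hf : GroupHamiltonian.IsStructureConstants f) (θ : ℝ) (hθ : θ ≠ 0) :
    -- the Hamiltonian is `-1/2` times the Laplace–Beltrami operator of the metric `g`
    (∀ X ∈ GroupHamiltonian.regularSet f θ, ∀ ψ : (Fin d → ℝ) → ℂ, ContDiffAt ℝ 2 ψ X →
      GroupHamiltonian.hamiltonian f θ ψ X =
        -(1 / 2) * GroupHamiltonian.laplaceBeltrami (GroupHamiltonian.metric f θ) ψ X) ∧
    -- `g` is the bi-invariant metric on the group manifold, with `g = δ` at the unity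
    GroupHamiltonian.metric f θ 0 = 1 ∧
    (∀ (N : ℕ) (t : Fin d → Matrix (Fin N) (Fin N) ℂ), GroupHamiltonian.IsRepresentation f t →
      (LinearIndependent ℝ t →
        GroupHamiltonian.IsBiInvariant (GroupHamiltonian.omega t θ)
          (GroupHamiltonian.metric f θ)) ∧
      (∀ h : ℝ, h ≠ 0 →
        (∀ a b, (t a * t b).trace = if a = b then (h : ℂ) else 0) →
        ∀ (X : Fin d → ℝ) (j k : Fin d),
          (GroupHamiltonian.metric f θ X j k : ℂ) = 1 / ((h : ℂ) * (θ : ℂ) ^ 2) *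
            (GroupHamiltonian.matPartialD j (fun Y => (GroupHamiltonian.omega t θ Y)⁻¹) X *
              GroupHamiltonian.matPartialD k (GroupHamiltonian.omega t θ) X).trace)) := by
  refine ⟨fun X hX ψ hψ => hf.hamiltonian_eq hX hψ, GroupHamiltonian.metric_zero f θ,
    fun N t ht => ⟨fun hli => ht.isBiInvariant hf hθ hli, fun h hh htr X j k =>
      ht.metric_apply_eq_trace hf hθ hh htr X j k⟩⟩
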